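/- Let $d, D \ge 2$ be integers. The random matrix product state (MPS) on $n$ sites is generated as follows: take independent Haar-random unitaries $U^{(1)}, \dots, U^{(n)} \in U(dD)$ acting on $\mathbb{C}^d \otimes \mathbb{C}^D$, initialize all $n$ sites (each $\mathbb{C}^d$) and the bond space $\mathbb{C}^D$ in $|0\rangle$, and apply $U^{(1)}, \dots, U^{(n)}$ one after the other, $U^{(j)}$ acting on site $j$ and the bond space; the final bond space becomes part of the last site. Let $n = c + a + r + b + f$ with $a, b, f \ge 1$ and $c, r \ge 0$; let $A$ consist of the $a$ consecutive sites that follow the first $c$ sites, and $B$ of the $b$ consecutive sites that follow the first $c+a+r$ sites. Write $\varrho_S$ for the reduced density matrix of the state on a set $S$ of sites. For all $n$ and all sets $S$ of sites that are taken without the final bond space, $\operatorname{tr}(\varrho_S^2)$ is integrable with a positive mean. The annealed average of the Rényi-2 mutual information (that is, with $\mathbb{E}\log X$ replaced by $\log \mathbb{E} X$) is $$ I_2^{(c)}(r) = \log \mathbb{E}\operatorname{tr}(\varrho_{AB}^2) - \log \mathbb{E}\operatorname{tr}(\varrho_A^2) - \log \mathbb{E}\operatorname{tr}(\varrho_B^2).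 $$ Say that $C(r)$ decays exponentially with correlation length $\xi$ if there are $K \neq 0$ and $0 < \chi < \xi$, independent of $r$, with $C(r) = K e^{-r/\xi} + O(e^{-r/\chi})$ as $r \to \infty$. For $\rho \in S_k$, $k \le dD$, let $T_\rho$ be the $k! \times k!$ matrix with entries $(T_\rho)_{\tau\theta} = \sum_{\sigma \in S_k} \mathrm{Wg}(\sigma\tau^{-1}, dD)\, d^{\#(\sigma\rho)} D^{\#(\sigma\theta^{-1})}$, where $\#$ counts cycles (fixed points included) and $\mathrm{Wg}(\sigma\tau^{-1}, q)$ are the entries of the inverse of the Gram matrix $\big(q^{\#(\sigma\tau^{-1})}\big)_{\sigma,\tau}$. Then: (i) For $k = 2$, in the basis $e, (1\,2)$ of $S_2$, $$ T_e = \begin{pmatrix} 1 & \frac{d^2 D - D}{d^2 D^2 - 1} \\ 0 & \frac{d D^2 - d}{d^2 D^2 - 1} \end{pmatrix}, $$ and its eigenvalues are $\lambda_1 = 1$ and $\lambda_2 = \frac{dD^2 - d}{d^2D^2 - 1} \in (0, 1)$. (ii) For all fixed $a, b, f \ge 1$ and $c \ge 0$, $I_2^{(c)}(r)$ decays exponentially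 with correlation length $$ \xi_{1\mathrm{D}} = -\left[\log\left(\frac{dD^2 - d}{d^2D^2 - 1}\right)\right]^{-1} = -\frac{1}{\log \lambda_2}. $$ (iii) For all fixed $a, b, f \ge 1$, the limit $I_2^{(\infty)}(r) = \lim_{c \to \infty} I_2^{(c)}(r)$ exists for every $r$, and it decays exponentially with the same correlation length $\xi_{1\mathrm{D}}$. -/

import Mathlib

open MeasureTheory Filter Topology Asymptotics

noncomputable section

namespace RandomMPS

/-! ### Haar measure on the unitary group -/

instance instMeasurableSpaceUnitary (ι : Type) [Fintype ι] [DecidableEq ι] :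
    MeasurableSpace (Matrix.unitaryGroup ι ℂ) := borel _

instance instBorelSpaceUnitary (ι : Type) [Fintype ι] [DecidableEq ι] :
    BorelSpace (Matrix.unitaryGroup ι ℂ) := ⟨rfl⟩

instance instCompactSpaceUnitary (ι : Type) [Fintype ι] [DecidableEq ι] :
    CompactSpace (Matrix.unitaryGroup ι ℂ) := by
  have hcl : IsClosed {A : Matrix ι ι ℂ | A ∈ Matrix.unitaryGroup ι ℂ} := by
    have h : {A : Matrix ι ι ℂ | A ∈ Matrix.unitaryGroup ι ℂ} = {A | A * star A = 1} := by
      ext A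
      exact Matrix.mem_unitaryGroup_iff
    rw [h]
    exact isClosed_eq (by fun_prop) continuous_const
  have hK : IsCompact (Set.pi Set.univ fun _ : ι => Set.pi Set.univ
      fun _ : ι => Metric.closedBall (0 : ℂ) 1) :=
    isCompact_univ_pi fun _ => isCompact_univ_pi fun _ => isCompact_closedBall _ _
  refine isCompact_iff_compactSpace.mp (hK.of_isClosed_subset hcl ?_)
  intro A hA i _ j _
  simpa using entry_norm_bound_of_unitary hA i j

/-- The Haar measure on `U(ι)`, normalized to total mass one. -/
def haarUnitary (ι : Type) [Fintype ι] [DecidableEq ι] : Measure (Matrix.unitaryGroup ι ℂ) :=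
  Measure.haarMeasure ⊤

instance instIsProbabilityMeasureHaar (ι : Type) [Fintype ι] [DecidableEq ι] :
    IsProbabilityMeasure (haarUnitary ι) :=
  ⟨by
    have h := Measure.haarMeasure_self
      (K₀ := (⊤ : TopologicalSpace.PositiveCompacts (Matrix.unitaryGroup ι ℂ)))
    simpa [haarUnitary] using h⟩

/-! ### The random MPS ensemble -/

/-- The gates: unitary matrices in `U(dD)`, acting on (one site) ⊗ (bond space). -/
abbrev Gate (d D : ℕ) := Matrix.unitaryGroup (Fin d × Fin D) ℂ

/-- The gates `U⁽¹⁾, …, U⁽ⁿ⁾` are independent and Haar distributed. -/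
def ensemble (d D n : ℕ) : Measure (Fin n → Gate d D) :=
  Measure.pi fun _ => haarUnitary (Fin d × Fin D)

/-- The local tensor of a gate applied to a site initialized in `|0⟩`, with outgoing physical
index `i`: its `(α, β)` entry is `⟨i, β| U |0, α⟩`, where `α` is the incoming and `β` the outgoing
bond index. -/
def localTensor {d D : ℕ} [NeZero d] (U : Gate d D) (i : Fin d) : Matrix (Fin D) (Fin D) ℂ :=
  Matrix.of fun α β => (U : Matrix (Fin d × Fin D) (Fin d × Fin D) ℂ) (i, β) (0, α)

/-- The sequentially generated state: all sites and the bond space start in `|0⟩`, and the gates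
`U⁽¹⁾, …, U⁽ⁿ⁾` are applied one after the other, `U⁽ʲ⁾` acting on site `j` and the bond space.
The amplitude at `(i, β)` belongs to the basis vector `|i₁ … iₙ⟩ ⊗ |β⟩`; the bond space that remains
after the last gate is part of the final site, which thus has dimension `dD`. -/
def mpsState {d D n : ℕ} [NeZero d] [NeZero D] (U : Fin n → Gate d D) :
    (Fin n → Fin d) × Fin D → ℂ :=
  fun x => (List.ofFn fun j => localTensor (U j) (x.1 j)).prod 0 x.2

/-- The reduced density matrix of `|ψ⟩⟨ψ|` on the sites in `S`: all the other sites and the bond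
space that remains at the end are traced out. -/
def reducedDensity {d D n : ℕ} (ψ : (Fin n → Fin d) × Fin D → ℂ) (S : Finset (Fin n)) :
    Matrix ({j // j ∈ S} → Fin d) ({j // j ∈ S} → Fin d) ℂ :=
  Matrix.of fun x y => ∑ z : {j // ¬ j ∈ S} → Fin d, ∑ β : Fin D,
    ψ ((Equiv.piEquivPiSubtypeProd (fun j => j ∈ S) fun _ => Fin d).symm (x, z), β) *
      star (ψ ((Equiv.piEquivPiSubtypeProd (fun j => j ∈ S) fun _ => Fin d).symm (y, z), β))

/-- The purity `tr (ϱ_S²)` of the state generated by `U`. -/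
def purity {d D n : ℕ} [NeZero d] [NeZero D] (S : Finset (Fin n)) (U : Fin n → Gate d D) : ℝ :=
  (reducedDensity (mpsState U) S * reducedDensity (mpsState U) S).trace.re

/-- The average purity `𝔼 tr (ϱ_S²)` over the ensemble. -/
def avgPurity (d D : ℕ) {n : ℕ} [NeZero d] [NeZero D] (S : Finset (Fin n)) : ℝ :=
  ∫ U, purity S U ∂(ensemble d D n)

/-- The `l` consecutive sites that follow the first `s` sites. -/
def block (n s l : ℕ) : Finset (Fin n) :=
  Finset.univ.filter fun j => s ≤ j.val ∧ j.val < s + l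

/-- The annealed average of the Rényi-2 mutual information
`I₂(A : B) = log tr (ϱ_AB²) - log tr (ϱ_A²) - log tr (ϱ_B²)`, where `𝔼 log X` is read as `log 𝔼 X`.
From left to right, in the order of generation: `c` sites, the `a` sites of `A`, `r` sites,
the `b` sites of `B`, and `f` further sites. -/
def annealedI2 (d D : ℕ) [NeZero d] [NeZero D] (c a r b f : ℕ) : ℝ :=
  let A := block (c + a + r + b + f) c a
  let B := block (c + a + r + b + f) (c + a + r) b
  Real.log (avgPurity d D (A ∪ B)) - Real.log (avgPurity d D A) - Real.log (avgPurity d D B)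

/-! ### Exponential decay -/

/-- `C r = K exp (-r / ξ) + O (exp (-r / χ))` as `r → ∞`, with `K ≠ 0` independent of `r` and
`0 < χ < ξ`: the correlation measure `C` decays exponentially with correlation length `ξ`. -/
def DecaysExponentially (C : ℕ → ℝ) (ξ : ℝ) : Prop :=
  ∃ K χ : ℝ, K ≠ 0 ∧ 0 < χ ∧ χ < ξ ∧
    (fun r : ℕ => C r - K * Real.exp (-(r : ℝ) / ξ)) =O[atTop]
      fun r : ℕ => Real.exp (-(r : ℝ) / χ)

/-- The correlation length `ξ_1D`. -/
def xi1D (d D : ℕ) : ℝ :=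
  -(Real.log (((d : ℝ) * (D : ℝ) ^ 2 - d) / ((d : ℝ) ^ 2 * (D : ℝ) ^ 2 - 1)))⁻¹

/-! ### Transfer matrices -/

/-- The number of cycles of a permutation, fixed points included. -/
def numCycles {k : ℕ} (σ : Equiv.Perm (Fin k)) : ℕ := Multiset.card σ.partition.parts

/-- The Gram matrix of the permutation operators on `(ℂ^q)^{⊗k}`. -/
def gram (k q : ℕ) : Matrix (Equiv.Perm (Fin k)) (Equiv.Perm (Fin k)) ℝ :=
  Matrix.of fun σ τ => (q : ℝ) ^ numCycles (σ * τ⁻¹)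

/-- The Weingarten matrix, with entries `Wg(σ τ⁻¹, q)`, for `k ≤ q` (where `gram k q` is
invertible). -/
def weingarten (k q : ℕ) : Matrix (Equiv.Perm (Fin k)) (Equiv.Perm (Fin k)) ℝ := (gram k q)⁻¹

/-- The transfer matrix `T_ρ`, `ρ ∈ S_k`, of the random MPS ensemble (for `k ≤ dD`): its `(τ, θ)`
entry is `∑ σ, Wg(σ τ⁻¹, dD) d^{#(σ ρ)} D^{#(σ θ⁻¹)}`. -/
def transferMatrix (k d D : ℕ) (ρ : Equiv.Perm (Fin k)) :
    Matrix (Equiv.Perm (Fin k)) (Equiv.Perm (Fin k)) ℝ :=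
  Matrix.of fun τ θ => ∑ σ, weingarten k (d * D) σ τ *
    (d : ℝ) ^ numCycles (σ * ρ) * (D : ℝ) ^ numCycles (σ * θ⁻¹)

end RandomMPS

end

/-! The purity of a set `S` is a two-copy quantity: `trace_reducedDensity_sq` writes tr ϱ_S² as an
overlap of two kets and two bras in which the bras' physical indices are exchanged exactly on `S`.
Averaging one gate U ⊗ U ⊗ Ū ⊗ Ū leaves only two tensors on the four bond legs, the parallel pairing
(1↔3, 2↔4) and the crossed one (1↔4, 2↔3); `haarMoment_eq` is this Weingarten formula. By
independence, `integral_overlap` turns the average over all gates into a product of 2 × 2 matrices,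
one per site, acting on the coefficients of the two pairings. The last bond is traced out, so the
product starts from (1, 0); the first bond is in |0⟩, where both pairings equal 1, so the purity is
the sum of the two coefficients.

A traced site has eigenvectors (1, 0) and (-κ, 1) with eigenvalues 1 and λ₂; a kept site is the same
with the components exchanged. Hence the averages for `A`, `B` and `A ∪ B` are explicit, `A` does
not depend on r, and the other two are affine in λ₂^r. After cancellation I₂ = log (1 + X λ₂^r) -
log (1 + Y λ₂^r) with X, Y ≥ 0, so the leading term is (X - Y) λ₂^r and the error is O(λ₂^(2r)). The
crux is X > Y (`decaysExponentially_log_purity`), which rests on the mean purity of `A` being below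
1. All formulas are continuous in t = λ₂^c, and c → ∞ is the case t = 0. -/

noncomputable section

namespace RandomMPS

/-! ### Fourth moments of Haar-random unitaries -/

section Invariant

variable {ι : Type} [Fintype ι] [DecidableEq ι]

/-- Invariance of a tensor `X` under `V ⊗ V ⊗ V̄ ⊗ V̄` for all unitary `V`. -/
def IsUnitaryInvariant (X : ι → ι → ι → ι → ℂ) : Prop :=
  ∀ (V : Matrix.unitaryGroup ι ℂ) (k₁ k₂ k₃ k₄ : ι), X k₁ k₂ k₃ k₄ =
    ∑ m₁, ∑ m₂, ∑ m₃, ∑ m₄, (V.1 k₁ m₁ * V.1 k₂ m₂ * star (V.1 k₃ m₃) * star (V.1 k₄ m₄)) *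
      X m₁ m₂ m₃ m₄

/-- The diagonal unitary with entry `I` at `l` and `1` elsewhere. -/
def phaseUnitary (l : ι) : Matrix.unitaryGroup ι ℂ :=
  ⟨Matrix.diagonal fun i => if i = l then Complex.I else 1, by
    rw [Matrix.mem_unitaryGroup_iff, Matrix.star_eq_conjTranspose, Matrix.diagonal_conjTranspose,
      Matrix.diagonal_mul_diagonal, ← Matrix.diagonal_one]
    congr 1
    funext i
    by_cases h : i = l <;> simp [h]⟩

/-- The permutation matrix of `π`, as a unitary. -/
def permUnitary (π : Equiv.Perm ι) : Matrix.unitaryGroup ι ℂ :=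
  ⟨Matrix.of fun i j => if π i = j then 1 else 0, by
    rw [Matrix.mem_unitaryGroup_iff]
    ext i j
    simp [Matrix.mul_apply, Matrix.one_apply, apply_ite, eq_comm]⟩

/-- The reflection `1 - (2 / q) J`, where `J` is the all-ones matrix and `q` the dimension. -/
def reflectionUnitary (ι : Type) [Fintype ι] [DecidableEq ι] [Nonempty ι] :
    Matrix.unitaryGroup ι ℂ :=
  ⟨Matrix.of fun i j => (if i = j then 1 else 0) - 2 / (Fintype.card ι : ℂ), by
    have hq : (Fintype.card ι : ℂ) ≠ 0 := by simp
    rw [Matrix.mem_unitaryGroup_iff]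
    ext i j
    simp only [Matrix.mul_apply, Matrix.of_apply, Matrix.star_apply, Matrix.one_apply]
    by_cases h : i = j
    · subst h
      simp [sub_mul, mul_sub, Finset.sum_sub_distrib]
      field_simp
      ring
    · simp [sub_mul, mul_sub, Finset.sum_sub_distrib, h]
      field_simp
      ring⟩

theorem IsUnitaryInvariant.phase {X : ι → ι → ι → ι → ℂ} (hX : IsUnitaryInvariant X)
    (l k₁ k₂ k₃ k₄ : ι) : X k₁ k₂ k₃ k₄ =
      ((if k₁ = l then Complex.I else 1) * (if k₂ = l then Complex.I else 1) *
        (if k₃ = l then -Complex.I else 1) * (if k₄ = l then -Complex.I else 1)) *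
        X k₁ k₂ k₃ k₄ := by
  conv_lhs => rw [hX (phaseUnitary l)]
  have hs : ∀ (i j : ι) (z : ℂ), star (if i = j then z else 0) = if i = j then star z else 0 := by
    intro i j z
    split_ifs <;> simp
  simp only [phaseUnitary, Matrix.diagonal_apply, hs, ite_mul, mul_ite, zero_mul, mul_zero,
    Finset.sum_ite_eq, Finset.mem_univ, if_true]
  split_ifs <;> simp

theorem IsUnitaryInvariant.perm {X : ι → ι → ι → ι → ℂ} (hX : IsUnitaryInvariant X)
    (π : Equiv.Perm ι) (k₁ k₂ k₃ k₄ : ι) : X k₁ k₂ k₃ k₄ = X (π k₁) (π k₂) (π k₃) (π k₄) := by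
  conv_lhs => rw [hX (permUnitary π)]
  simp [permUnitary, apply_ite, ite_mul]

theorem IsUnitaryInvariant.eq_zero {X : ι → ι → ι → ι → ℂ} (hX : IsUnitaryInvariant X)
    {k₁ k₂ k₃ k₄ : ι} (h₁ : ¬ (k₁ = k₃ ∧ k₂ = k₄)) (h₂ : ¬ (k₁ = k₄ ∧ k₂ = k₃)) :
    X k₁ k₂ k₃ k₄ = 0 := by
  have key : ∀ z : ℂ, z ≠ 1 → X k₁ k₂ k₃ k₄ = z * X k₁ k₂ k₃ k₄ → X k₁ k₂ k₃ k₄ = 0 := by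
    intro z hz h
    have : (z - 1) * X k₁ k₂ k₃ k₄ = 0 := by linear_combination -h
    exact (mul_eq_zero.1 this).resolve_left (sub_ne_zero.2 hz)
  have hI : Complex.I ≠ 1 := fun h => by simpa using congrArg Complex.re h
  have hI2 : (-1 : ℂ) ≠ 1 := by norm_num
  -- If {k₁, k₂} and {k₃, k₄} differ as multisets, the phase at k₁ or at k₂ multiplies the entry by
  -- some z ≠ 1. The phase is I because a sign -1 would not detect k₁ = k₂ with k₃, k₄ both
  -- different.
  have e₁ := hX.phase k₁ k₁ k₂ k₃ k₄
  have e₂ := hX.phase k₂ k₁ k₂ k₃ k₄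
  by_cases a : k₂ = k₁ <;> by_cases b : k₃ = k₁ <;> by_cases c : k₄ = k₁ <;>
    by_cases d : k₃ = k₂ <;> by_cases e : k₄ = k₂ <;>
    first
    | (exfalso; grind)
    | (refine key _ ?_ e₁; simp [a, b, c, hI, hI2]; done)
    | (refine key _ ?_ e₂; simp [Ne.symm a, d, e, hI])

theorem exists_perm_apply_eq {ι : Type} [DecidableEq ι] {i j i₀ j₀ : ι} (h : i ≠ j) (h₀ : i₀ ≠ j₀) :
    ∃ π : Equiv.Perm ι, π i = i₀ ∧ π j = j₀ := by
  refine ⟨Equiv.swap (Equiv.swap i i₀ j) j₀ * Equiv.swap i i₀, ?_, ?_⟩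
  · have h' : Equiv.swap i i₀ j ≠ i₀ := fun e => h <| by
      simpa using congrArg (Equiv.swap i i₀) e.symm
    simp [Equiv.swap_apply_of_ne_of_ne h'.symm h₀]
  · simp

/-- An invariant tensor is a combination of the two pairings. -/
theorem IsUnitaryInvariant.exists_eq {X : ι → ι → ι → ι → ℂ} (hX : IsUnitaryInvariant X)
    (hq : 3 ≤ Fintype.card ι) : ∃ a b : ℂ, ∀ k₁ k₂ k₃ k₄, X k₁ k₂ k₃ k₄ =
      a * ((1 : Matrix ι ι ℂ) k₁ k₃ * (1 : Matrix ι ι ℂ) k₂ k₄) +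
      b * ((1 : Matrix ι ι ℂ) k₁ k₄ * (1 : Matrix ι ι ℂ) k₂ k₃) := by
  obtain ⟨i₀, j₀, h₀⟩ := Fintype.one_lt_card_iff.1 (by omega : 1 < Fintype.card ι)
  have : Nonempty ι := ⟨i₀⟩
  set c := X i₀ i₀ i₀ i₀ - X i₀ j₀ i₀ j₀ - X i₀ j₀ j₀ i₀ with hc
  have form : ∀ k₁ k₂ k₃ k₄, X k₁ k₂ k₃ k₄ =
      X i₀ j₀ i₀ j₀ * ((1 : Matrix ι ι ℂ) k₁ k₃ * (1 : Matrix ι ι ℂ) k₂ k₄) +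
      X i₀ j₀ j₀ i₀ * ((1 : Matrix ι ι ℂ) k₁ k₄ * (1 : Matrix ι ι ℂ) k₂ k₃) +
      c * ((1 : Matrix ι ι ℂ) k₁ k₂ * (1 : Matrix ι ι ℂ) k₁ k₃ * (1 : Matrix ι ι ℂ) k₁ k₄) := by
    intro k₁ k₂ k₃ k₄
    by_cases h₁ : k₁ = k₃ ∧ k₂ = k₄
    · obtain ⟨rfl, rfl⟩ := h₁
      by_cases h : k₁ = k₂
      · subst h
        rw [hX.perm (Equiv.swap k₁ i₀)]
        simp [hc]
      · obtain ⟨π, rfl, rfl⟩ := exists_perm_apply_eq h h₀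
        rw [hX.perm π]
        simp [h, Ne.symm h]
    · by_cases h₂ : k₁ = k₄ ∧ k₂ = k₃
      · obtain ⟨rfl, rfl⟩ := h₂
        have h : k₁ ≠ k₂ := fun h => h₁ ⟨h, h.symm⟩
        obtain ⟨π, rfl, rfl⟩ := exists_perm_apply_eq h h₀
        rw [hX.perm π]
        simp [h, Ne.symm h]
      · rw [hX.eq_zero h₁ h₂]
        simp only [Matrix.one_apply]
        grind
  suffices c = 0 by
    refine ⟨X i₀ j₀ i₀ j₀, X i₀ j₀ j₀ i₀, fun k₁ k₂ k₃ k₄ => ?_⟩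
    rw [form, this, zero_mul, add_zero]
  set A := X i₀ j₀ i₀ j₀
  set B := X i₀ j₀ j₀ i₀
  set t : ℂ := 2 / (Fintype.card ι : ℂ) with ht
  set v : ι → ℂ := fun m => (if i₀ = m then 1 else 0) - t with hv
  have hqt : (Fintype.card ι : ℂ) * t = 2 := by rw [ht]; field_simp
  have hvV : ∀ m, (reflectionUnitary ι).1 i₀ m = v m := fun m => rfl
  have hvs : ∀ m, star (v m) = v m := fun m => by
    simp [hv, ht, apply_ite]
  -- The row `v` of the reflection has norm 1, so invariance at this entry reads A + B + c = A + B +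
  -- c ∑ v⁴.
  have key := hX (reflectionUnitary ι) i₀ i₀ i₀ i₀
  simp only [form, hvV, hvs] at key
  have row : ∑ m, v m * v m = 1 := by
    have := congrFun (congrFun (Matrix.mem_unitaryGroup_iff.1 (reflectionUnitary ι).2) i₀) i₀
    simpa [Matrix.mul_apply, hvV, ← Complex.star_def, hvs] using this
  have quartic : ∑ m, v m * v m * v m * v m = 1 - 4 * t + 6 * t ^ 2 - 2 * t ^ 3 := by
    have h : ∀ m, v m * v m * v m * v m =
        (if i₀ = m then 1 - 4 * t + 6 * t ^ 2 - 4 * t ^ 3 else 0) + t ^ 4 := by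
      intro m
      simp only [hv]
      split_ifs <;> ring
    simp only [h, Finset.sum_add_distrib, Finset.sum_ite_eq, Finset.mem_univ, if_true,
      Finset.sum_const, Finset.card_univ, nsmul_eq_mul]
    linear_combination t ^ 3 * hqt
  have hsum : ∑ m₁, ∑ m₂, ∑ m₃, ∑ m₄, (v m₁ * v m₂ * v m₃ * v m₄) *
      (A * ((1 : Matrix ι ι ℂ) m₁ m₃ * (1 : Matrix ι ι ℂ) m₂ m₄) +
        B * ((1 : Matrix ι ι ℂ) m₁ m₄ * (1 : Matrix ι ι ℂ) m₂ m₃) +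
        c * ((1 : Matrix ι ι ℂ) m₁ m₂ * (1 : Matrix ι ι ℂ) m₁ m₃ * (1 : Matrix ι ι ℂ) m₁ m₄)) =
      A * (∑ m, v m * v m) * (∑ m, v m * v m) + B * (∑ m, v m * v m) * (∑ m, v m * v m) +
        c * ∑ m, v m * v m * v m * v m := by
    simp only [mul_add, Finset.sum_add_distrib, Matrix.one_apply, mul_ite, mul_one, mul_zero,
      Finset.sum_ite_eq, Finset.mem_univ, if_true, Finset.mul_sum, Finset.sum_mul]
    refine congrArg₂ _ (congrArg₂ _ ?_ ?_) ?_
    · exact Finset.sum_congr rfl fun _ _ => Finset.sum_congr rfl fun _ _ => by ring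
    · refine Finset.sum_congr rfl fun _ _ => Finset.sum_congr rfl fun _ _ => ?_
      rw [Finset.sum_comm]
      simp only [Finset.sum_ite_eq, Finset.mem_univ, if_true]
      ring
    · exact Finset.sum_congr rfl fun _ _ => by ring
  rw [hsum, row, quartic] at key
  simp only [Matrix.one_apply_eq] at key
  -- Since t = 2 / q, the roots t = 1 and t = 2 are the dimensions q = 2 and q = 1.
  have h1 : c * (2 * t * (t - 1) * (t - 2)) = 0 := by linear_combination key
  have hqn : ∀ n : ℕ, n < 3 → (Fintype.card ι : ℂ) ≠ n := fun n hn h => by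
    have := Nat.cast_injective h
    omega
  have ht0 : t ≠ 0 := by simp [ht]
  have ht1 : t - 1 ≠ 0 := fun h => hqn 2 (by norm_num) (by
    rw [sub_eq_zero] at h
    rw [h] at hqt
    simpa using hqt)
  have ht2 : t - 2 ≠ 0 := fun h => hqn 1 (by norm_num) (by
    rw [sub_eq_zero] at h
    rw [h] at hqt
    simpa using hqt)
  simpa [ht0, ht1, ht2] using h1

end Invariant

/-! ### Haar integration and the Weingarten formula for two copies. -/

section Haar

variable {ι : Type} [Fintype ι] [DecidableEq ι]

instance instIsMulLeftInvariantHaar : (haarUnitary ι).IsMulLeftInvariant := by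
  unfold haarUnitary
  infer_instance

theorem continuous_unitary_entry (k l : ι) :
    Continuous fun U : Matrix.unitaryGroup ι ℂ => U.1 k l :=
  continuous_subtype_val.matrix_elem k l

theorem integrable_haarUnitary {f : Matrix.unitaryGroup ι ℂ → ℂ} (hf : Continuous f) :
    Integrable f (haarUnitary ι) :=
  hf.integrable_of_hasCompactSupport (HasCompactSupport.of_compactSpace f)

/-- The fourth moments of the entries of a Haar-random unitary. -/
def haarMoment (k₁ k₂ k₃ k₄ l₁ l₂ l₃ l₄ : ι) : ℂ :=
  ∫ U, U.1 k₁ l₁ * U.1 k₂ l₂ * star (U.1 k₃ l₃) * star (U.1 k₄ l₄) ∂haarUnitary ι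

theorem continuous_four_entries (k₁ k₂ k₃ k₄ l₁ l₂ l₃ l₄ : ι) :
    Continuous fun U : Matrix.unitaryGroup ι ℂ =>
      U.1 k₁ l₁ * U.1 k₂ l₂ * star (U.1 k₃ l₃) * star (U.1 k₄ l₄) :=
  (((continuous_unitary_entry _ _).mul (continuous_unitary_entry _ _)).mul
    (continuous_unitary_entry _ _).star).mul (continuous_unitary_entry _ _).star

theorem sum_mul_sum_mul_sum_mul_sum {κ : Type} [Fintype κ] (a b c d : κ → ℂ) :
    (∑ i, a i) * (∑ i, b i) * (∑ i, c i) * (∑ i, d i) =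
      ∑ i, ∑ j, ∑ k, ∑ l, a i * b j * c k * d l := by
  simp only [← Finset.mul_sum, ← Finset.sum_mul]

theorem isUnitaryInvariant_haarMoment (l₁ l₂ l₃ l₄ : ι) :
    IsUnitaryInvariant fun k₁ k₂ k₃ k₄ => haarMoment k₁ k₂ k₃ k₄ l₁ l₂ l₃ l₄ := by
  intro V k₁ k₂ k₃ k₄
  have hint : ∀ (z : ℂ) (m₁ m₂ m₃ m₄ : ι), Integrable (fun U : Matrix.unitaryGroup ι ℂ =>
      z * (U.1 m₁ l₁ * U.1 m₂ l₂ * star (U.1 m₃ l₃) * star (U.1 m₄ l₄))) (haarUnitary ι) :=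
    fun z m₁ m₂ m₃ m₄ => integrable_haarUnitary
      (continuous_const.mul (continuous_four_entries _ _ _ _ _ _ _ _))
  simp only [haarMoment]
  -- Replacing U by VU and expanding the four matrix products gives the invariance in the row
  -- indices.
  rw [← integral_mul_left_eq_self _ V]
  simp only [← integral_const_mul]
  have hs : ∀ m₁ m₂ m₃ : ι, Integrable (fun U : Matrix.unitaryGroup ι ℂ => ∑ m₄,
      (V.1 k₁ m₁ * V.1 k₂ m₂ * star (V.1 k₃ m₃) * star (V.1 k₄ m₄)) *
      (U.1 m₁ l₁ * U.1 m₂ l₂ * star (U.1 m₃ l₃) * star (U.1 m₄ l₄))) (haarUnitary ι) :=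
    fun _ _ _ => integrable_finsetSum _ fun _ _ => hint _ _ _ _ _
  have hs' : ∀ m₁ m₂ : ι, Integrable (fun U : Matrix.unitaryGroup ι ℂ => ∑ m₃, ∑ m₄,
      (V.1 k₁ m₁ * V.1 k₂ m₂ * star (V.1 k₃ m₃) * star (V.1 k₄ m₄)) *
      (U.1 m₁ l₁ * U.1 m₂ l₂ * star (U.1 m₃ l₃) * star (U.1 m₄ l₄))) (haarUnitary ι) :=
    fun _ _ => integrable_finsetSum _ fun _ _ => hs _ _ _
  have hs'' : ∀ m₁ : ι, Integrable (fun U : Matrix.unitaryGroup ι ℂ => ∑ m₂, ∑ m₃, ∑ m₄,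
      (V.1 k₁ m₁ * V.1 k₂ m₂ * star (V.1 k₃ m₃) * star (V.1 k₄ m₄)) *
      (U.1 m₁ l₁ * U.1 m₂ l₂ * star (U.1 m₃ l₃) * star (U.1 m₄ l₄))) (haarUnitary ι) :=
    fun _ => integrable_finsetSum _ fun _ _ => hs' _ _
  simp only [← integral_finsetSum _ fun m _ => hint _ _ _ _ m,
    ← integral_finsetSum _ fun m _ => hs _ _ m, ← integral_finsetSum _ fun m _ => hs' _ m,
    ← integral_finsetSum _ fun m _ => hs'' m]
  congr 1
  funext U
  simp only [Submonoid.coe_mul, Matrix.mul_apply, star_sum, star_mul', sum_mul_sum_mul_sum_mul_sum]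
  refine Finset.sum_congr rfl fun _ _ => Finset.sum_congr rfl fun _ _ =>
    Finset.sum_congr rfl fun _ _ => Finset.sum_congr rfl fun _ _ => by ring

theorem sum_entry_mul_star (U : Matrix.unitaryGroup ι ℂ) (l l' : ι) :
    ∑ k, U.1 k l * star (U.1 k l') = (1 : Matrix ι ι ℂ) l l' := by
  have := congrFun (congrFun (Matrix.mem_unitaryGroup_iff'.1 U.2) l') l
  simp only [Matrix.mul_apply, Matrix.star_apply] at this
  rw [Matrix.one_apply] at this ⊢
  simpa only [mul_comm, eq_comm] using this

/-- The columns of a unitary are orthonormal, so the contracted integrand is constant. With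
`haarMoment_swap`, this also gives the crossed contraction. -/
theorem sum_haarMoment_parallel (l₁ l₂ l₃ l₄ : ι) :
    ∑ k₁, ∑ k₂, haarMoment k₁ k₂ k₁ k₂ l₁ l₂ l₃ l₄ =
      (1 : Matrix ι ι ℂ) l₁ l₃ * (1 : Matrix ι ι ℂ) l₂ l₄ := by
  have hint : ∀ k₁ k₂ : ι, Integrable (fun U : Matrix.unitaryGroup ι ℂ =>
      U.1 k₁ l₁ * U.1 k₂ l₂ * star (U.1 k₁ l₃) * star (U.1 k₂ l₄)) (haarUnitary ι) :=
    fun _ _ => integrable_haarUnitary (continuous_four_entries _ _ _ _ _ _ _ _)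
  simp only [haarMoment, ← integral_finsetSum _ fun m _ => hint _ m]
  rw [← integral_finsetSum _ fun m _ => integrable_finsetSum _ fun k _ => hint m k]
  have h : ∀ U : Matrix.unitaryGroup ι ℂ,
      ∑ k₁, ∑ k₂, U.1 k₁ l₁ * U.1 k₂ l₂ * star (U.1 k₁ l₃) * star (U.1 k₂ l₄) =
        (1 : Matrix ι ι ℂ) l₁ l₃ * (1 : Matrix ι ι ℂ) l₂ l₄ := by
    intro U
    rw [← sum_entry_mul_star U, ← sum_entry_mul_star U, Finset.sum_mul_sum]
    exact Finset.sum_congr rfl fun _ _ => Finset.sum_congr rfl fun _ _ => by ring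
  rw [integral_congr_ae (ae_of_all _ h)]
  simp

theorem haarMoment_swap (k₁ k₂ k₃ k₄ l₁ l₂ l₃ l₄ : ι) :
    haarMoment k₁ k₂ k₃ k₄ l₁ l₂ l₃ l₄ = haarMoment k₁ k₂ k₄ k₃ l₁ l₂ l₄ l₃ := by
  simp only [haarMoment, mul_right_comm]

/-- The Weingarten formula for the fourth moments. -/
theorem haarMoment_eq (hq : 3 ≤ Fintype.card ι) (k₁ k₂ k₃ k₄ l₁ l₂ l₃ l₄ : ι) :
    (Fintype.card ι : ℂ) * ((Fintype.card ι : ℂ) ^ 2 - 1) *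
      haarMoment k₁ k₂ k₃ k₄ l₁ l₂ l₃ l₄ =
      (Fintype.card ι * ((1 : Matrix ι ι ℂ) l₁ l₃ * (1 : Matrix ι ι ℂ) l₂ l₄) -
        (1 : Matrix ι ι ℂ) l₁ l₄ * (1 : Matrix ι ι ℂ) l₂ l₃) *
        ((1 : Matrix ι ι ℂ) k₁ k₃ * (1 : Matrix ι ι ℂ) k₂ k₄) +
      (Fintype.card ι * ((1 : Matrix ι ι ℂ) l₁ l₄ * (1 : Matrix ι ι ℂ) l₂ l₃) -
        (1 : Matrix ι ι ℂ) l₁ l₃ * (1 : Matrix ι ι ℂ) l₂ l₄) *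
        ((1 : Matrix ι ι ℂ) k₁ k₄ * (1 : Matrix ι ι ℂ) k₂ k₃) := by
  obtain ⟨a, b, h⟩ := (isUnitaryInvariant_haarMoment l₁ l₂ l₃ l₄).exists_eq hq
  have h₁ := sum_haarMoment_parallel l₁ l₂ l₃ l₄
  have h₂ := sum_haarMoment_parallel l₁ l₂ l₄ l₃
  simp only [haarMoment_swap _ _ _ _ l₁ l₂ l₄ l₃] at h₂
  simp only [h, Finset.sum_add_distrib, ← Finset.mul_sum, Matrix.one_apply_eq] at h₁ h₂
  have hdd : ∑ i : ι, ∑ j : ι, (1 : Matrix ι ι ℂ) i j * (1 : Matrix ι ι ℂ) j i =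
      Fintype.card ι := by
    simp [Matrix.one_apply]
  simp only [hdd, mul_one, Finset.sum_const, Finset.card_univ, nsmul_eq_mul] at h₁ h₂
  -- The two contractions read q²a + qb and qa + q²b; the claim is the solution of this linear
  -- system, with denominators cleared.
  rw [h, ← h₁, ← h₂]
  ring

end Haar

/-! ### The averaged two-copy recursion -/

/-- The second eigenvalue of the transfer matrix. -/
def lam (d D : ℕ) : ℝ := ((d : ℝ) * (D : ℝ) ^ 2 - d) / ((d : ℝ) ^ 2 * (D : ℝ) ^ 2 - 1)

/-- The off-diagonal entry of the transfer matrix. -/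
def mu (d D : ℕ) : ℝ := ((d : ℝ) ^ 2 * D - D) / ((d : ℝ) ^ 2 * (D : ℝ) ^ 2 - 1)

/-- The action of an averaged site on the coefficients of the two pairings of the bond spaces;
`s` tells whether the site is kept. -/
def siteStep (d D : ℕ) (s : Bool) (v : ℝ × ℝ) : ℝ × ℝ :=
  if s then (lam d D * v.1, v.2 + mu d D * v.1) else (v.1 + mu d D * v.2, lam d D * v.2)

/-- The coefficients of the two pairings after averaging over a list of sites. -/
def pairingCoeff (d D : ℕ) (l : List Bool) : ℝ × ℝ := l.foldr (siteStep d D) (1, 0)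

/-- The amplitude of the state generated from the bond state `α`. -/
def amplitude {d D n : ℕ} [NeZero d] (U : Fin n → Gate d D) (x : Fin n → Fin d) (α β : Fin D) :
    ℂ :=
  (List.ofFn fun j => localTensor (U j) (x j)).prod α β

/-- The configuration that agrees with `u` where `s` holds and with `v` elsewhere. -/
def mix {d n : ℕ} (s : Fin n → Bool) (u v : Fin n → Fin d) : Fin n → Fin d :=
  fun j => if s j then u j else v j

/-- The two-copy overlap with given incoming bond indices. -/
def overlap {d D n : ℕ} [NeZero d] (s : Fin n → Bool) (U : Fin n → Gate d D)
    (α₁ α₂ α₃ α₄ : Fin D) : ℂ :=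
  ∑ u₁, ∑ u₂, ∑ β₁, ∑ β₂, amplitude U u₁ α₁ β₁ * amplitude U u₂ α₂ β₂ *
    star (amplitude U (mix s u₂ u₁) α₃ β₁) * star (amplitude U (mix s u₁ u₂) α₄ β₂)

section Recursion

variable {d D n : ℕ} [NeZero d]

theorem amplitude_cons (U : Fin (n + 1) → Gate d D) (i : Fin d) (x : Fin n → Fin d)
    (α γ : Fin D) : amplitude U (Fin.cons i x) α γ =
      ∑ β, (U 0).1 (i, β) (0, α) * amplitude (Fin.tail U) x β γ := by
  simp [amplitude, List.ofFn_succ, Matrix.mul_apply, localTensor, Fin.tail]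

omit [NeZero d] in
theorem mix_cons (s : Fin (n + 1) → Bool) (i j : Fin d) (u v : Fin n → Fin d) :
    mix s (Fin.cons i u : Fin (n + 1) → Fin d) (Fin.cons j v) =
      Fin.cons (if s 0 then i else j) (mix (Fin.tail s) u v) := by
  funext k
  refine Fin.cases ?_ (fun k => ?_) k <;> rfl

theorem sum_fin_cons {κ : Type} [Fintype κ] (f : (Fin (n + 1) → κ) → ℂ) :
    ∑ u, f u = ∑ i, ∑ x : Fin n → κ, f (Fin.cons i x) := by
  rw [← (Fin.consEquiv fun _ : Fin (n + 1) => κ).sum_comp, Fintype.sum_prod_type]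
  rfl

theorem sum_rotate {A B C E K : Type} [Fintype A] [Fintype B] [Fintype C] [Fintype E] [Fintype K]
    (f : A → B → C → E → K → ℂ) :
    ∑ a, ∑ b, ∑ c, ∑ e, ∑ k, f a b c e k = ∑ k, ∑ a, ∑ b, ∑ c, ∑ e, f a b c e k :=
  (Finset.sum_congr rfl fun _ _ => (Finset.sum_congr rfl fun _ _ =>
    (Finset.sum_congr rfl fun _ _ => Finset.sum_comm).trans Finset.sum_comm).trans
      Finset.sum_comm).trans Finset.sum_comm

theorem sum_mul_sum_mul_sum_mul_sum' {κ : Type} [Fintype κ] (a b c d : κ → ℂ) :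
    (∑ i, a i) * (∑ i, b i) * (∑ i, c i) * (∑ i, d i) =
      ∑ k : κ × κ × κ × κ, a k.1 * b k.2.1 * c k.2.2.1 * d k.2.2.2 := by
  simp only [Fintype.sum_prod_type, sum_mul_sum_mul_sum_mul_sum]

/-- Peels off the first gate, whose outgoing bond legs are the incoming legs of the rest. This is
the recursion behind `integral_overlap`. -/
theorem overlap_succ (s : Fin (n + 1) → Bool) (U : Fin (n + 1) → Gate d D)
    (α₁ α₂ α₃ α₄ : Fin D) : overlap s U α₁ α₂ α₃ α₄ =
      ∑ i₁, ∑ i₂, ∑ β : Fin D × Fin D × Fin D × Fin D,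
        ((U 0).1 (i₁, β.1) (0, α₁) * (U 0).1 (i₂, β.2.1) (0, α₂) *
          star ((U 0).1 (if s 0 then i₂ else i₁, β.2.2.1) (0, α₃)) *
          star ((U 0).1 (if s 0 then i₁ else i₂, β.2.2.2) (0, α₄))) *
        overlap (Fin.tail s) (Fin.tail U) β.1 β.2.1 β.2.2.1 β.2.2.2 := by
  rw [overlap, sum_fin_cons]
  refine Finset.sum_congr rfl fun i₁ _ => ?_
  simp only [sum_fin_cons (κ := Fin d) (n := n)]
  rw [Finset.sum_comm]
  refine Finset.sum_congr rfl fun i₂ _ => ?_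
  simp only [mix_cons, amplitude_cons, star_sum, star_mul', sum_mul_sum_mul_sum_mul_sum', overlap]
  simp only [Finset.mul_sum]
  rw [sum_rotate]
  exact Finset.sum_congr rfl fun _ _ => Finset.sum_congr rfl fun _ _ =>
    Finset.sum_congr rfl fun _ _ => Finset.sum_congr rfl fun _ _ =>
      Finset.sum_congr rfl fun _ _ => by ring

theorem continuous_amplitude (x : Fin n → Fin d) (α β : Fin D) :
    Continuous fun U : Fin n → Gate d D => amplitude U x α β := by
  induction n generalizing α β with
  | zero => simpa [amplitude] using continuous_const
  | succ n ih =>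
    obtain ⟨i, x, rfl⟩ : ∃ i y, x = Fin.cons i y := ⟨x 0, Fin.tail x, (Fin.cons_self_tail x).symm⟩
    simp only [amplitude_cons]
    refine continuous_finsetSum _ fun γ _ => ?_
    refine ((continuous_unitary_entry _ _).comp (continuous_apply 0)).mul ((ih x γ β).comp ?_)
    exact continuous_pi fun j => continuous_apply j.succ

theorem continuous_overlap (s : Fin n → Bool) (α₁ α₂ α₃ α₄ : Fin D) :
    Continuous fun U : Fin n → Gate d D => overlap s U α₁ α₂ α₃ α₄ := by
  unfold overlap
  refine continuous_finsetSum _ fun _ _ => continuous_finsetSum _ fun _ _ =>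
    continuous_finsetSum _ fun _ _ => continuous_finsetSum _ fun _ _ => ?_
  exact (((continuous_amplitude _ _ _).mul (continuous_amplitude _ _ _)).mul
    (continuous_amplitude _ _ _).star).mul (continuous_amplitude _ _ _).star

/-- Makes the product σ-algebra on families of gates the Borel one, so that continuous functions of
all gates are measurable. -/
instance instSecondCountableUnitary (ι : Type) [Fintype ι] [DecidableEq ι] :
    SecondCountableTopology (Matrix.unitaryGroup ι ℂ) :=
  haveI : SecondCountableTopology (Matrix ι ι ℂ) :=
    inferInstanceAs (SecondCountableTopology (ι → ι → ℂ))
  TopologicalSpace.Subtype.secondCountableTopology _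

instance instIsProbabilityMeasureEnsemble (d D n : ℕ) :
    IsProbabilityMeasure (ensemble d D n) := by
  unfold ensemble
  infer_instance

omit [NeZero d] in
theorem integrable_ensemble {E : Type} [NormedAddCommGroup E] {f : (Fin n → Gate d D) → E}
    (hf : Continuous f) : Integrable f (ensemble d D n) :=
  hf.integrable_of_hasCompactSupport (HasCompactSupport.of_compactSpace f)

omit [NeZero d] in
theorem integral_ensemble_succ (f : Gate d D → ℂ) (g : (Fin n → Gate d D) → ℂ) :
    ∫ U, f (U 0) * g (Fin.tail U) ∂ensemble d D (n + 1) =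
      (∫ V, f V ∂haarUnitary (Fin d × Fin D)) * ∫ U, g U ∂ensemble d D n := by
  have h := (measurePreserving_piFinSuccAbove
    (fun _ : Fin (n + 1) => haarUnitary (Fin d × Fin D)) 0).symm
  rw [ensemble, ← h.integral_comp', ← integral_prod_mul]
  rfl

omit [NeZero d] in
theorem one_prod_apply (i i' : Fin d) (β β' : Fin D) :
    (1 : Matrix (Fin d × Fin D) (Fin d × Fin D) ℂ) (i, β) (i', β') =
      (1 : Matrix (Fin d) (Fin d) ℂ) i i' * (1 : Matrix (Fin D) (Fin D) ℂ) β β' := by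
  by_cases h : i = i' <;> simp [Matrix.one_apply, h]

omit [NeZero d] in
-- Loop counting: two pairings contract to D² or d² if they agree and to D or d if they differ.
-- Keeping the site (`s` true) exchanges the physical indices of the bras, hence the roles of d and
-- d².
theorem sum_pairing_mul_pairing (s : Bool) (x y p r : ℂ) :
    ∑ i₁ : Fin d, ∑ i₂ : Fin d, ∑ β : Fin D × Fin D × Fin D × Fin D,
      (x * ((1 : Matrix (Fin d × Fin D) (Fin d × Fin D) ℂ)
            (i₁, β.1) (if s then i₂ else i₁, β.2.2.1) *
          (1 : Matrix (Fin d × Fin D) (Fin d × Fin D) ℂ)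
            (i₂, β.2.1) (if s then i₁ else i₂, β.2.2.2)) +
        y * ((1 : Matrix (Fin d × Fin D) (Fin d × Fin D) ℂ)
            (i₁, β.1) (if s then i₁ else i₂, β.2.2.2) *
          (1 : Matrix (Fin d × Fin D) (Fin d × Fin D) ℂ)
            (i₂, β.2.1) (if s then i₂ else i₁, β.2.2.1))) *
      (p * ((1 : Matrix (Fin D) (Fin D) ℂ) β.1 β.2.2.1 *
          (1 : Matrix (Fin D) (Fin D) ℂ) β.2.1 β.2.2.2) +
        r * ((1 : Matrix (Fin D) (Fin D) ℂ) β.1 β.2.2.2 *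
          (1 : Matrix (Fin D) (Fin D) ℂ) β.2.1 β.2.2.1)) =
      x * (if s then (d : ℂ) else d ^ 2) * (p * D ^ 2 + r * D) +
        y * (if s then (d : ℂ) ^ 2 else d) * (p * D + r * D ^ 2) := by
  have h1 : ∀ i j : Fin d, (1 : Matrix (Fin d) (Fin d) ℂ) i j * (1 : Matrix (Fin d) (Fin d) ℂ) j i
      = (1 : Matrix (Fin d) (Fin d) ℂ) i j := fun i j => by
    by_cases h : i = j
    · subst h
      simp
    · simp [Matrix.one_apply, h]
  have h2 : ∑ i : Fin d, ∑ j : Fin d, (1 : Matrix (Fin d) (Fin d) ℂ) i j = d := by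
    simp [Matrix.one_apply]
  have h3 : ∀ z : ℂ, ∑ β : Fin D × Fin D × Fin D × Fin D,
      z * (((1 : Matrix (Fin D) (Fin D) ℂ) β.1 β.2.2.1 * (1 : Matrix (Fin D) (Fin D) ℂ) β.2.1 β.2.2.2) *
      (p * ((1 : Matrix (Fin D) (Fin D) ℂ) β.1 β.2.2.1 *
          (1 : Matrix (Fin D) (Fin D) ℂ) β.2.1 β.2.2.2) +
        r * ((1 : Matrix (Fin D) (Fin D) ℂ) β.1 β.2.2.2 *
          (1 : Matrix (Fin D) (Fin D) ℂ) β.2.1 β.2.2.1))) = z * (p * D ^ 2 + r * D) := by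
    intro z
    rw [← Finset.mul_sum]
    congr 1
    simp [Fintype.sum_prod_type, Matrix.one_apply, mul_add, Finset.sum_add_distrib]
    ring
  have h4 : ∀ z : ℂ, ∑ β : Fin D × Fin D × Fin D × Fin D,
      z * (((1 : Matrix (Fin D) (Fin D) ℂ) β.1 β.2.2.2 * (1 : Matrix (Fin D) (Fin D) ℂ) β.2.1 β.2.2.1) *
      (p * ((1 : Matrix (Fin D) (Fin D) ℂ) β.1 β.2.2.1 *
          (1 : Matrix (Fin D) (Fin D) ℂ) β.2.1 β.2.2.2) +
        r * ((1 : Matrix (Fin D) (Fin D) ℂ) β.1 β.2.2.2 *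
          (1 : Matrix (Fin D) (Fin D) ℂ) β.2.1 β.2.2.1))) = z * (p * D + r * D ^ 2) := by
    intro z
    rw [← Finset.mul_sum]
    congr 1
    simp [Fintype.sum_prod_type, Matrix.one_apply, mul_add, Finset.sum_add_distrib]
    ring
  have h5 : ∀ z w : ℂ, ∑ i : Fin d, ∑ j : Fin d, (z + w * (1 : Matrix (Fin d) (Fin d) ℂ) i j) =
      d ^ 2 * z + d * w := by
    intro z w
    simp only [Finset.sum_add_distrib, ← Finset.mul_sum, h2]
    simp
    ring
  cases s
  · have e1 : ∀ i j : Fin d, (if false = true then j else i) = i := fun _ _ => rfl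
    calc _ = ∑ i : Fin d, ∑ j : Fin d, (x * (p * (D : ℂ) ^ 2 + r * D) +
          (y * (p * D + r * (D : ℂ) ^ 2)) * (1 : Matrix (Fin d) (Fin d) ℂ) i j) := ?_
      _ = _ := by
        rw [h5]
        simp
        ring
    refine Finset.sum_congr rfl fun i _ => Finset.sum_congr rfl fun j _ => ?_
    rw [← h3, mul_right_comm, ← h4, ← Finset.sum_add_distrib]
    refine Finset.sum_congr rfl fun β _ => ?_
    rw [e1, e1, one_prod_apply, one_prod_apply, one_prod_apply, one_prod_apply,
      Matrix.one_apply_eq, Matrix.one_apply_eq]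
    linear_combination (y * (1 : Matrix (Fin D) (Fin D) ℂ) β.1 β.2.2.2 *
      (1 : Matrix (Fin D) (Fin D) ℂ) β.2.1 β.2.2.1 * (p * ((1 : Matrix (Fin D) (Fin D) ℂ) β.1 β.2.2.1 *
        (1 : Matrix (Fin D) (Fin D) ℂ) β.2.1 β.2.2.2) +
      r * ((1 : Matrix (Fin D) (Fin D) ℂ) β.1 β.2.2.2 *
        (1 : Matrix (Fin D) (Fin D) ℂ) β.2.1 β.2.2.1))) * h1 i j
  · have e1 : ∀ i j : Fin d, (if true = true then j else i) = j := fun _ _ => rfl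
    calc _ = ∑ i : Fin d, ∑ j : Fin d, (y * (p * D + r * (D : ℂ) ^ 2) +
          (x * (p * (D : ℂ) ^ 2 + r * D)) * (1 : Matrix (Fin d) (Fin d) ℂ) i j) := ?_
      _ = _ := by
        rw [h5]
        simp
        ring
    refine Finset.sum_congr rfl fun i _ => Finset.sum_congr rfl fun j _ => ?_
    rw [← h4, mul_right_comm, ← h3, ← Finset.sum_add_distrib]
    refine Finset.sum_congr rfl fun β _ => ?_
    rw [e1, e1, one_prod_apply, one_prod_apply, one_prod_apply, one_prod_apply,
      Matrix.one_apply_eq, Matrix.one_apply_eq]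
    linear_combination (x * (1 : Matrix (Fin D) (Fin D) ℂ) β.1 β.2.2.1 *
      (1 : Matrix (Fin D) (Fin D) ℂ) β.2.1 β.2.2.2 * (p * ((1 : Matrix (Fin D) (Fin D) ℂ) β.1 β.2.2.1 *
        (1 : Matrix (Fin D) (Fin D) ℂ) β.2.1 β.2.2.2) +
      r * ((1 : Matrix (Fin D) (Fin D) ℂ) β.1 β.2.2.2 *
        (1 : Matrix (Fin D) (Fin D) ℂ) β.2.1 β.2.2.1))) * h1 i j

theorem sum_haarMoment_site (hd : 2 ≤ d) (hD : 2 ≤ D) (s : Bool) (v : ℝ × ℝ)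
    (α₁ α₂ α₃ α₄ : Fin D) :
    ∑ i₁ : Fin d, ∑ i₂ : Fin d, ∑ β : Fin D × Fin D × Fin D × Fin D,
      haarMoment (i₁, β.1) (i₂, β.2.1) (if s then i₂ else i₁, β.2.2.1)
        (if s then i₁ else i₂, β.2.2.2) (0, α₁) (0, α₂) (0, α₃) (0, α₄) *
      ((v.1 : ℂ) * ((1 : Matrix (Fin D) (Fin D) ℂ) β.1 β.2.2.1 *
          (1 : Matrix (Fin D) (Fin D) ℂ) β.2.1 β.2.2.2) +
        (v.2 : ℂ) * ((1 : Matrix (Fin D) (Fin D) ℂ) β.1 β.2.2.2 *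
          (1 : Matrix (Fin D) (Fin D) ℂ) β.2.1 β.2.2.1)) =
      ((siteStep d D s v).1 : ℂ) * ((1 : Matrix (Fin D) (Fin D) ℂ) α₁ α₃ *
          (1 : Matrix (Fin D) (Fin D) ℂ) α₂ α₄) +
        ((siteStep d D s v).2 : ℂ) * ((1 : Matrix (Fin D) (Fin D) ℂ) α₁ α₄ *
          (1 : Matrix (Fin D) (Fin D) ℂ) α₂ α₃) := by
  have hq : 3 ≤ Fintype.card (Fin d × Fin D) := by
    simp only [Fintype.card_prod, Fintype.card_fin]
    nlinarith
  have hd' : (2 : ℝ) ≤ d := by exact_mod_cast hd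
  have hD' : (2 : ℝ) ≤ D := by exact_mod_cast hD
  have hN : (d : ℂ) ^ 2 * (D : ℂ) ^ 2 - 1 ≠ 0 := by
    have : (d : ℝ) ^ 2 * (D : ℝ) ^ 2 - 1 ≠ 0 := by
      nlinarith [mul_le_mul hd' hD' (by norm_num) (by linarith)]
    exact_mod_cast this
  have hd0 : (d : ℂ) ≠ 0 := by
    have : (d : ℝ) ≠ 0 := by linarith
    exact_mod_cast this
  have hD0 : (D : ℂ) ≠ 0 := by
    have : (D : ℝ) ≠ 0 := by linarith
    exact_mod_cast this
  have hM : ((Fintype.card (Fin d × Fin D) : ℕ) : ℂ) *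
      (((Fintype.card (Fin d × Fin D) : ℕ) : ℂ) ^ 2 - 1) ≠ 0 := by
    simp only [Fintype.card_prod, Fintype.card_fin, Nat.cast_mul, mul_pow]
    exact mul_ne_zero (mul_ne_zero hd0 hD0) hN
  refine mul_left_cancel₀ hM ?_
  simp only [Finset.mul_sum, ← mul_assoc (((Fintype.card (Fin d × Fin D) : ℕ) : ℂ) * _)
    (haarMoment _ _ _ _ _ _ _ _), haarMoment_eq hq]
  rw [sum_pairing_mul_pairing]
  simp only [one_prod_apply, Matrix.one_apply_eq, one_mul, Fintype.card_prod, Fintype.card_fin,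
    Nat.cast_mul]
  cases s <;>
  · simp [siteStep, lam, mu]
    field_simp
    ring

/-- The average of the two-copy overlap is a combination of the two pairings. -/
theorem integral_overlap (hd : 2 ≤ d) (hD : 2 ≤ D) (s : Fin n → Bool) (α₁ α₂ α₃ α₄ : Fin D) :
    ∫ U, overlap s U α₁ α₂ α₃ α₄ ∂ensemble d D n =
      ((pairingCoeff d D (List.ofFn s)).1 : ℂ) * ((1 : Matrix (Fin D) (Fin D) ℂ) α₁ α₃ *
          (1 : Matrix (Fin D) (Fin D) ℂ) α₂ α₄) +
        ((pairingCoeff d D (List.ofFn s)).2 : ℂ) * ((1 : Matrix (Fin D) (Fin D) ℂ) α₁ α₄ *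
          (1 : Matrix (Fin D) (Fin D) ℂ) α₂ α₃) := by
  induction n generalizing α₁ α₂ α₃ α₄ with
  | zero =>
    have hs : ∀ (i j : Fin D), star ((1 : Matrix (Fin D) (Fin D) ℂ) i j) =
        (1 : Matrix (Fin D) (Fin D) ℂ) i j := fun i j => by
      by_cases h : i = j
      · subst h
        simp
      · simp [h]
    -- With no site left, tracing out the final bond joins each ket to its own bra: the parallel
    -- pairing, coefficients (1, 0).
    have h : ∀ U : Fin 0 → Gate d D, overlap s U α₁ α₂ α₃ α₄ =
        (1 : Matrix (Fin D) (Fin D) ℂ) α₁ α₃ * (1 : Matrix (Fin D) (Fin D) ℂ) α₂ α₄ := by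
      intro U
      simp only [overlap, amplitude, List.ofFn_zero, List.prod_nil, hs]
      simp only [Matrix.one_apply]
      simp
    simp [h, pairingCoeff]
  | succ n ih =>
    have hint : ∀ (i₁ i₂ : Fin d) (β : Fin D × Fin D × Fin D × Fin D),
        Integrable (fun U : Fin (n + 1) → Gate d D =>
          ((U 0).1 (i₁, β.1) (0, α₁) * (U 0).1 (i₂, β.2.1) (0, α₂) *
            star ((U 0).1 (if s 0 then i₂ else i₁, β.2.2.1) (0, α₃)) *
            star ((U 0).1 (if s 0 then i₁ else i₂, β.2.2.2) (0, α₄))) *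
          overlap (Fin.tail s) (Fin.tail U) β.1 β.2.1 β.2.2.1 β.2.2.2)
          (ensemble d D (n + 1)) := fun i₁ i₂ β => by
      refine integrable_ensemble (((continuous_four_entries _ _ _ _ _ _ _ _).comp
        (continuous_apply 0)).mul ((continuous_overlap _ _ _ _ _).comp ?_))
      exact continuous_pi fun j => continuous_apply j.succ
    simp only [overlap_succ]
    rw [integral_finsetSum _ fun i _ => integrable_finsetSum _ fun j _ =>
      integrable_finsetSum _ fun β _ => hint i j β]
    simp only [integral_finsetSum _ fun j _ => integrable_finsetSum _ fun β _ => hint _ j β,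
      integral_finsetSum _ fun β _ => hint _ _ β]
    have hfac : ∀ (i₁ i₂ : Fin d) (β : Fin D × Fin D × Fin D × Fin D),
        ∫ U : Fin (n + 1) → Gate d D,
          ((U 0).1 (i₁, β.1) (0, α₁) * (U 0).1 (i₂, β.2.1) (0, α₂) *
            star ((U 0).1 (if s 0 then i₂ else i₁, β.2.2.1) (0, α₃)) *
            star ((U 0).1 (if s 0 then i₁ else i₂, β.2.2.2) (0, α₄))) *
          overlap (Fin.tail s) (Fin.tail U) β.1 β.2.1 β.2.2.1 β.2.2.2 ∂ensemble d D (n + 1) =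
        haarMoment (i₁, β.1) (i₂, β.2.1) (if s 0 then i₂ else i₁, β.2.2.1)
          (if s 0 then i₁ else i₂, β.2.2.2) (0, α₁) (0, α₂) (0, α₃) (0, α₄) *
        ∫ U, overlap (Fin.tail s) U β.1 β.2.1 β.2.2.1 β.2.2.2 ∂ensemble d D n :=
      fun i₁ i₂ β => integral_ensemble_succ (fun V : Gate d D =>
        V.1 (i₁, β.1) (0, α₁) * V.1 (i₂, β.2.1) (0, α₂) *
          star (V.1 (if s 0 then i₂ else i₁, β.2.2.1) (0, α₃)) *
          star (V.1 (if s 0 then i₁ else i₂, β.2.2.2) (0, α₄)))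
        fun U => overlap (Fin.tail s) U β.1 β.2.1 β.2.2.1 β.2.2.2
    simp only [hfac, ih]
    rw [sum_haarMoment_site hd hD, List.ofFn_succ]
    rfl

omit [NeZero d] in
theorem mix_piEquivPiSubtypeProd_symm (S : Finset (Fin n)) (x y : {j // j ∈ S} → Fin d)
    (z w : {j // ¬ j ∈ S} → Fin d) :
    mix (fun j => decide (j ∈ S))
      ((Equiv.piEquivPiSubtypeProd (fun j => j ∈ S) fun _ => Fin d).symm (x, z))
      ((Equiv.piEquivPiSubtypeProd (fun j => j ∈ S) fun _ => Fin d).symm (y, w)) =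
      (Equiv.piEquivPiSubtypeProd (fun j => j ∈ S) fun _ => Fin d).symm (x, w) := by
  funext j
  by_cases h : j ∈ S <;> simp [mix, h]

/-- The swap trick: the matrix product joins the indices in `S` across the copies, while the partial
trace joins the others within each copy. The bras thus carry the mixed configurations. -/
theorem trace_reducedDensity_sq [NeZero D] (S : Finset (Fin n)) (U : Fin n → Gate d D) :
    (reducedDensity (mpsState U) S * reducedDensity (mpsState U) S).trace =
      overlap (fun j => decide (j ∈ S)) U 0 0 0 0 := by
  have hsum : ∀ f : (Fin n → Fin d) → ℂ, ∑ u, f u = ∑ x, ∑ z,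
      f ((Equiv.piEquivPiSubtypeProd (fun j => j ∈ S) fun _ => Fin d).symm (x, z)) := by
    intro f
    rw [← (Equiv.piEquivPiSubtypeProd (fun j => j ∈ S) fun _ => Fin d).symm.sum_comp,
      Fintype.sum_prod_type]
  have hψ : ∀ (u : Fin n → Fin d) (β : Fin D), mpsState U (u, β) = amplitude U u 0 β :=
    fun _ _ => rfl
  simp only [overlap, hsum, mix_piEquivPiSubtypeProd_symm, Matrix.trace, Matrix.diag_apply,
    Matrix.mul_apply, reducedDensity, Matrix.of_apply, hψ, Finset.sum_mul_sum]
  refine Finset.sum_congr rfl fun x _ => ?_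
  rw [Finset.sum_comm]
  exact Finset.sum_congr rfl fun _ _ => Finset.sum_congr rfl fun _ _ =>
    Finset.sum_congr rfl fun _ _ => Finset.sum_congr rfl fun _ _ =>
      Finset.sum_congr rfl fun _ _ => by ring

theorem integrable_purity [NeZero D] (S : Finset (Fin n)) :
    Integrable (purity (d := d) (D := D) S) (ensemble d D n) := by
  have h : purity (d := d) (D := D) S =
      fun U => (overlap (fun j => decide (j ∈ S)) U 0 0 0 0).re :=
    funext fun U => congrArg Complex.re (trace_reducedDensity_sq S U)
  rw [h]
  exact integrable_ensemble (Complex.continuous_re.comp (continuous_overlap _ _ _ _ _))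

theorem avgPurity_eq [NeZero D] (hd : 2 ≤ d) (hD : 2 ≤ D) (S : Finset (Fin n)) :
    avgPurity d D S = (pairingCoeff d D (List.ofFn fun j => decide (j ∈ S))).1 +
      (pairingCoeff d D (List.ofFn fun j => decide (j ∈ S))).2 := by
  have h : avgPurity d D S =
      ∫ U, (overlap (fun j => decide (j ∈ S)) U 0 0 0 0).re ∂ensemble d D n := by
    simp only [avgPurity, purity, trace_reducedDensity_sq]
  have h' := integral_re (𝕜 := ℂ) (μ := ensemble d D n) (integrable_ensemble
    (continuous_overlap (d := d) (D := D) (fun j => decide (j ∈ S)) 0 0 0 0))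
  rw [h]
  refine h'.trans ?_
  rw [integral_overlap hd hD]
  simp

end Recursion

/-! ### Signs of the matrix entries and positivity of the mean purity. -/

section Coefficients

variable {d D : ℕ}

theorem lam_pos (hd : 2 ≤ d) (hD : 2 ≤ D) : 0 < lam d D := by
  have hd' : (2 : ℝ) ≤ d := by exact_mod_cast hd
  have hD' : (2 : ℝ) ≤ D := by exact_mod_cast hD
  have := mul_le_mul hd' hD' (by norm_num) (by linarith)
  exact div_pos (by nlinarith) (by nlinarith)

theorem lam_lt_one (hd : 2 ≤ d) (hD : 2 ≤ D) : lam d D < 1 := by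
  have hd' : (2 : ℝ) ≤ d := by exact_mod_cast hd
  have hD' : (2 : ℝ) ≤ D := by exact_mod_cast hD
  have := mul_le_mul hd' hD' (by norm_num) (by linarith)
  rw [lam, div_lt_one (by nlinarith)]
  nlinarith [mul_pos (by linarith : (0 : ℝ) < d - 1) (by positivity : (0 : ℝ) < d * D ^ 2 + 1)]

theorem mu_pos (hd : 2 ≤ d) (hD : 2 ≤ D) : 0 < mu d D := by
  have hd' : (2 : ℝ) ≤ d := by exact_mod_cast hd
  have hD' : (2 : ℝ) ≤ D := by exact_mod_cast hD
  have := mul_le_mul hd' hD' (by norm_num) (by linarith)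
  exact div_pos (by nlinarith) (by nlinarith)

theorem pairingCoeff_pos (hd : 2 ≤ d) (hD : 2 ≤ D) (l : List Bool) :
    0 ≤ (pairingCoeff d D l).1 ∧ 0 ≤ (pairingCoeff d D l).2 ∧
      0 < (pairingCoeff d D l).1 + (pairingCoeff d D l).2 := by
  have hl := lam_pos hd hD
  have hm := mu_pos hd hD
  induction l with
  | nil => simp [pairingCoeff]
  | cons s l ih =>
    have h : pairingCoeff d D (s :: l) = siteStep d D s (pairingCoeff d D l) := rfl
    obtain ⟨h₁, h₂, h₃⟩ := ih
    have h₄ := mul_nonneg hm.le h₁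
    have h₅ := mul_nonneg hm.le h₂
    have h₆ := mul_nonneg hl.le h₁
    have h₇ := mul_nonneg hl.le h₂
    have h₈ := mul_pos hl h₃
    have h₉ := mul_pos hm h₃
    rw [h]
    cases s <;> simp only [siteStep, if_true, Bool.false_eq_true, if_false] <;>
      refine ⟨?_, ?_, ?_⟩ <;> first | positivity | skip
    · rcases h₁.eq_or_lt with h | h
      · rw [← h] at h₃ ⊢
        nlinarith
      · linarith
    · rcases h₂.eq_or_lt with h | h
      · rw [← h] at h₃ ⊢
        nlinarith
      · linarith

end Coefficients

/-! ### Average purities of blocks -/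

/-- The fixed point ratio `μ / (1 - λ₂)` of an averaged site. -/
def kap (d D : ℕ) : ℝ := mu d D / (1 - lam d D)

section Blocks

variable {d D : ℕ}

theorem kap_mul (hd : 2 ≤ d) (hD : 2 ≤ D) : kap d D * (1 - lam d D) = mu d D :=
  div_mul_cancel₀ _ (sub_pos.2 (lam_lt_one hd hD)).ne'

theorem kap_pos (hd : 2 ≤ d) (hD : 2 ≤ D) : 0 < kap d D :=
  div_pos (mu_pos hd hD) (sub_pos.2 (lam_lt_one hd hD))

theorem kap_lt_one (hd : 2 ≤ d) (hD : 2 ≤ D) : kap d D < 1 := by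
  have hd' : (2 : ℝ) ≤ d := by exact_mod_cast hd
  have hD' : (2 : ℝ) ≤ D := by exact_mod_cast hD
  have h := mul_le_mul hd' hD' (by norm_num) (by linarith)
  have hN : (0 : ℝ) < (d : ℝ) ^ 2 * (D : ℝ) ^ 2 - 1 := by nlinarith
  rw [kap, div_lt_one (sub_pos.2 (lam_lt_one hd hD)), lt_sub_iff_add_lt, mu, lam, ← add_div,
    div_lt_one hN]
  -- This product is exactly the numerator of 1 - λ₂ - μ.
  have h1 : (0 : ℝ) < (d - 1) * ((D - 1) * (d * D - 1)) := by
    refine mul_pos (by linarith) (mul_pos (by linarith) (by linarith))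
  nlinarith

/-- Powers in the eigenbasis (1, 0), (-κ, 1) with eigenvalues 1, λ₂. In particular (1, 0) is fixed,
so traced sites at the end of the chain have no effect. -/
theorem foldr_siteStep_false (hd : 2 ≤ d) (hD : 2 ≤ D) (m : ℕ) (v : ℝ × ℝ) :
    (List.replicate m false).foldr (siteStep d D) v =
      (v.1 + kap d D * (1 - lam d D ^ m) * v.2, lam d D ^ m * v.2) := by
  induction m with
  | zero => simp
  | succ m ih =>
    rw [List.replicate_succ, List.foldr_cons, ih]
    simp only [siteStep, Bool.false_eq_true, if_false, Prod.mk.injEq]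
    constructor
    · linear_combination (-(lam d D ^ m * v.2)) * kap_mul hd hD
    · ring

theorem foldr_siteStep_true (hd : 2 ≤ d) (hD : 2 ≤ D) (m : ℕ) (v : ℝ × ℝ) :
    (List.replicate m true).foldr (siteStep d D) v =
      (lam d D ^ m * v.1, v.2 + kap d D * (1 - lam d D ^ m) * v.1) := by
  induction m with
  | zero => simp
  | succ m ih =>
    rw [List.replicate_succ, List.foldr_cons, ih]
    simp only [siteStep, if_true, Prod.mk.injEq]
    constructor
    · ring
    · linear_combination (-(lam d D ^ m * v.1)) * kap_mul hd hD

theorem ofFn_mem_block (s l e : ℕ) {n : ℕ} (hn : n = s + l + e) :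
    List.ofFn (fun j => decide (j ∈ block n s l)) =
      List.replicate s false ++ (List.replicate l true ++ List.replicate e false) := by
  subst hn
  refine List.ext_getElem (by simp; ring) fun i h₁ h₂ => ?_
  simp only [List.getElem_ofFn, List.getElem_append, List.getElem_replicate, block,
    Finset.mem_filter, Finset.mem_univ, true_and, List.length_replicate]
  grind

theorem ofFn_mem_block_union (c a r b f : ℕ) :
    List.ofFn (fun j => decide (j ∈ block (c + a + r + b + f) c a ∪
        block (c + a + r + b + f) (c + a + r) b)) =
      List.replicate c false ++ (List.replicate a true ++ (List.replicate r false ++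
        (List.replicate b true ++ List.replicate f false))) := by
  refine List.ext_getElem (by simp; ring) fun i h₁ h₂ => ?_
  simp only [List.getElem_ofFn, List.getElem_append, List.getElem_replicate, block,
    Finset.mem_filter, Finset.mem_univ, true_and, List.length_replicate, Finset.mem_union]
  grind

/-- The average purity of the block `A`, where `u = λ₂ ^ a` and `t = λ₂ ^ c`. -/
def purityA (κ u t : ℝ) : ℝ := u + (κ + (1 - κ) * t) * κ * (1 - u)

/-- The average purity of the block `B`, where `u = λ₂ ^ a`, `w = λ₂ ^ b`, `t = λ₂ ^ c` and
`x = λ₂ ^ r`. -/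
def purityB (κ u w t x : ℝ) : ℝ := w + κ ^ 2 * (1 - w) + (1 - κ) * t * u * (κ * (1 - w)) * x

/-- The average purity of `A ∪ B`, in the same variables. -/
def purityAB (κ u w t x : ℝ) : ℝ :=
  purityA κ u t * (w + κ ^ 2 * (1 - w)) +
    (κ + (1 - κ) * t - κ * purityA κ u t) * (κ * (1 - w)) * x

variable [NeZero d] [NeZero D]

theorem avgPurity_block (hd : 2 ≤ d) (hD : 2 ≤ D) (s l e : ℕ) {n : ℕ} (hn : n = s + l + e) :
    avgPurity d D (block n s l) = purityA (kap d D) (lam d D ^ l) (lam d D ^ s) := by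
  rw [avgPurity_eq hd hD, ofFn_mem_block s l e hn]
  simp only [pairingCoeff, List.foldr_append, foldr_siteStep_false hd hD,
    foldr_siteStep_true hd hD, purityA]
  ring

/-- For `B` alone all c + a + r preceding sites are traced out, which is why its purity contains the
product t u x. -/
theorem annealedI2_eq (hd : 2 ≤ d) (hD : 2 ≤ D) (c a r b f : ℕ) :
    annealedI2 d D c a r b f =
      Real.log (purityAB (kap d D) (lam d D ^ a) (lam d D ^ b) (lam d D ^ c) (lam d D ^ r)) -
      Real.log (purityA (kap d D) (lam d D ^ a) (lam d D ^ c)) -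
      Real.log (purityB (kap d D) (lam d D ^ a) (lam d D ^ b) (lam d D ^ c) (lam d D ^ r)) := by
  have hAB : avgPurity d D (block (c + a + r + b + f) c a ∪
      block (c + a + r + b + f) (c + a + r) b) =
      purityAB (kap d D) (lam d D ^ a) (lam d D ^ b) (lam d D ^ c) (lam d D ^ r) := by
    rw [avgPurity_eq hd hD, ofFn_mem_block_union]
    simp only [pairingCoeff, List.foldr_append, foldr_siteStep_false hd hD,
      foldr_siteStep_true hd hD, purityAB, purityA]
    ring
  have hB : avgPurity d D (block (c + a + r + b + f) (c + a + r) b) =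
      purityB (kap d D) (lam d D ^ a) (lam d D ^ b) (lam d D ^ c) (lam d D ^ r) := by
    rw [avgPurity_block hd hD (c + a + r) b f rfl]
    simp only [purityA, purityB, pow_add]
    ring
  simp only [annealedI2, hAB, hB]
  rw [avgPurity_block hd hD c a (r + b + f) (by ring)]

end Blocks

/-! ### Exponential decay -/

theorem abs_log_one_add_sub_le {z : ℝ} (hz : 0 ≤ z) : |Real.log (1 + z) - z| ≤ z ^ 2 := by
  have h₁ := Real.log_le_sub_one_of_pos (by linarith : 0 < 1 + z)
  have h₂ := Real.one_sub_inv_le_log_of_pos (by linarith : 0 < 1 + z)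
  -- The right side is z / (1 + z), the standard lower bound for log (1 + z).
  have h₃ : z - z ^ 2 ≤ 1 - (1 + z)⁻¹ := by
    rw [le_sub_iff_add_le, ← le_sub_iff_add_le', inv_le_iff_one_le_mul₀ (by linarith)]
    nlinarith [pow_nonneg hz 3]
  rw [abs_le]
  constructor <;> nlinarith

theorem decaysExponentially_log_sub_log {l x y : ℝ} (hl : 0 < l) (hl' : l < 1) (hx : 0 ≤ x)
    (hy : 0 ≤ y) (hxy : x ≠ y) {C : ℕ → ℝ}
    (hC : ∀ r, C r = Real.log (1 + x * l ^ r) - Real.log (1 + y * l ^ r)) :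
    DecaysExponentially C (-(Real.log l)⁻¹) := by
  have hlog : Real.log l < 0 := Real.log_neg hl hl'
  have hξ : 0 < -(Real.log l)⁻¹ := neg_pos.2 (inv_lt_zero.2 hlog)
  have e₁ : ∀ r : ℕ, Real.exp (-(r : ℝ) / -(Real.log l)⁻¹) = l ^ r := fun r => by
    rw [neg_div_neg_eq, div_inv_eq_mul, Real.exp_nat_mul, Real.exp_log hl]
  have e₂ : ∀ r : ℕ, Real.exp (-(r : ℝ) / (-(Real.log l)⁻¹ / 2)) = (l ^ r) ^ 2 := fun r => by
    rw [← e₁, ← Real.exp_nat_mul]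
    congr 1
    field_simp
    simp
  -- Halving the correlation length squares l ^ r, which matches the quadratic error of the
  -- logarithm.
  refine ⟨x - y, -(Real.log l)⁻¹ / 2, sub_ne_zero.2 hxy, half_pos hξ, half_lt_self hξ, ?_⟩
  refine IsBigO.of_bound (x ^ 2 + y ^ 2) (Eventually.of_forall fun r => ?_)
  rw [e₁, e₂, hC, Real.norm_eq_abs, Real.norm_of_nonneg (by positivity)]
  have hp : 0 ≤ l ^ r := by positivity
  have h₁ := abs_le.1 (abs_log_one_add_sub_le (mul_nonneg hx hp))
  have h₂ := abs_le.1 (abs_log_one_add_sub_le (mul_nonneg hy hp))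
  rw [abs_le]
  constructor <;> nlinarith

/-! ### Bounds on the explicit purities, the decay of I₂ and the limit c → ∞. -/

section Purities

variable {κ u w t x : ℝ}

theorem purityA_pos (hκ : 0 < κ) (hκ' : κ < 1) (hu : 0 < u) (hu' : u < 1) (ht : 0 ≤ t) :
    0 < purityA κ u t := by
  have h₁ : 0 < 1 - κ := by linarith
  have h₂ : 0 < 1 - u := by linarith
  unfold purityA
  positivity

theorem purityA_lt_one (hκ : 0 < κ) (hκ' : κ < 1) (hu' : u < 1) (ht' : t ≤ 1) :
    purityA κ u t < 1 := by
  have h₁ : κ + (1 - κ) * t ≤ 1 := by nlinarith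
  have h₂ : (κ + (1 - κ) * t) * κ < 1 := by nlinarith
  unfold purityA
  nlinarith

theorem purityB_pos (hκ : 0 < κ) (hκ' : κ < 1) (hu : 0 < u) (hw : 0 < w) (hw' : w < 1)
    (ht : 0 ≤ t) (hx : 0 ≤ x) : 0 < purityB κ u w t x := by
  have h₁ : 0 < 1 - κ := by linarith
  have h₂ : 0 < 1 - w := by linarith
  unfold purityB
  positivity

/-- This is the value on the decaying eigenvector (-κ, 1) of the remaining `A` and initial sites:
(0, 1) yields κ + (1 - κ) t and (1, 0) yields the purity of `A`. -/
theorem gain_sub_pos (hκ : 0 < κ) (hκ' : κ < 1) (hu' : u < 1) (ht : 0 ≤ t) (ht' : t ≤ 1) :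
    0 < κ + (1 - κ) * t - κ * purityA κ u t := by
  have h := purityA_lt_one hκ hκ' hu' ht'
  nlinarith [mul_nonneg (sub_nonneg.2 hκ'.le) ht, mul_lt_mul_of_pos_left h hκ]

theorem purityAB_pos (hκ : 0 < κ) (hκ' : κ < 1) (hu : 0 < u) (hu' : u < 1) (hw : 0 < w)
    (hw' : w < 1) (ht : 0 ≤ t) (ht' : t ≤ 1) (hx : 0 ≤ x) : 0 < purityAB κ u w t x := by
  have h₁ := gain_sub_pos hκ hκ' hu' ht ht'
  have h₂ : 0 < 1 - w := by linarith
  have h₃ := purityA_pos hκ hκ' hu hu' ht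
  unfold purityAB
  positivity

theorem decaysExponentially_log_purity {l : ℝ} (hl : 0 < l) (hl' : l < 1) (hκ : 0 < κ)
    (hκ' : κ < 1) (hu : 0 < u) (hu' : u < 1) (hw : 0 < w) (hw' : w < 1) (ht : 0 ≤ t)
    (ht' : t ≤ 1) :
    DecaysExponentially (fun r => Real.log (purityAB κ u w t (l ^ r)) -
      Real.log (purityA κ u t) - Real.log (purityB κ u w t (l ^ r))) (-(Real.log l)⁻¹) := by
  have hA := purityA_pos hκ hκ' hu hu' ht
  have hA' := purityA_lt_one hκ hκ' hu' ht'
  have hg := gain_sub_pos hκ hκ' hu' ht ht'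
  have h₁ : 0 < 1 - w := by linarith
  have h₂ : 0 < 1 - κ := by linarith
  have hZ : 0 < w + κ ^ 2 * (1 - w) := by positivity
  have hQ : 0 < κ * (1 - w) := by positivity
  refine decaysExponentially_log_sub_log hl hl'
    (x := (κ + (1 - κ) * t - κ * purityA κ u t) * (κ * (1 - w)) /
      (purityA κ u t * (w + κ ^ 2 * (1 - w))))
    (y := (1 - κ) * t * u * (κ * (1 - w)) / (w + κ ^ 2 * (1 - w)))
    (by positivity) (by positivity) (ne_of_gt ?_) fun r => ?_
  · rw [div_lt_div_iff₀ hZ (by positivity)]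
    -- After u ≤ 1 is used on the left, the difference is (κ + (1 - κ) t)(1 - P) with P the purity
    -- of `A`, positive because P < 1.
    have h : (1 - κ) * t * u * purityA κ u t < κ + (1 - κ) * t - κ * purityA κ u t := by
      have h₃ : (1 - κ) * t * u * purityA κ u t ≤ (1 - κ) * t * purityA κ u t := by
        refine mul_le_mul_of_nonneg_right ?_ hA.le
        exact mul_le_of_le_one_right (by positivity) hu'.le
      have h₄ : 0 < (κ + (1 - κ) * t) * (1 - purityA κ u t) :=
        mul_pos (by positivity) (by linarith)
      linarith
    have := mul_lt_mul_of_pos_right h (mul_pos hQ hZ)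
    linarith
  · have hp : 0 ≤ l ^ r := by positivity
    have e₁ : purityAB κ u w t (l ^ r) = purityA κ u t * ((w + κ ^ 2 * (1 - w)) *
        (1 + (κ + (1 - κ) * t - κ * purityA κ u t) * (κ * (1 - w)) /
          (purityA κ u t * (w + κ ^ 2 * (1 - w))) * l ^ r)) := by
      unfold purityAB
      field_simp
    have e₂ : purityB κ u w t (l ^ r) = (w + κ ^ 2 * (1 - w)) *
        (1 + (1 - κ) * t * u * (κ * (1 - w)) / (w + κ ^ 2 * (1 - w)) * l ^ r) := by
      unfold purityB
      field_simp
    rw [e₁, e₂, Real.log_mul hA.ne' (by positivity), Real.log_mul hZ.ne' (by positivity),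
      Real.log_mul hZ.ne' (by positivity)]
    ring

theorem tendsto_log_purity {l : ℝ} (hl : 0 < l) (hl' : l < 1) (hκ : 0 < κ) (hκ' : κ < 1)
    (hu : 0 < u) (hu' : u < 1) (hw : 0 < w) (hw' : w < 1) (hx : 0 ≤ x) :
    Tendsto (fun c : ℕ => Real.log (purityAB κ u w (l ^ c) x) - Real.log (purityA κ u (l ^ c)) -
      Real.log (purityB κ u w (l ^ c) x)) atTop
      (𝓝 (Real.log (purityAB κ u w 0 x) - Real.log (purityA κ u 0) -
        Real.log (purityB κ u w 0 x))) := by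
  have h := tendsto_pow_atTop_nhds_zero_of_lt_one hl.le hl'
  have c₁ : Continuous fun t => purityAB κ u w t x := by
    unfold purityAB purityA
    fun_prop
  have c₂ : Continuous fun t => purityA κ u t := by
    unfold purityA
    fun_prop
  have c₃ : Continuous fun t => purityB κ u w t x := by
    unfold purityB
    fun_prop
  refine ((((c₁.tendsto 0).comp h).log ?_).sub (((c₂.tendsto 0).comp h).log ?_)).sub
    (((c₃.tendsto 0).comp h).log ?_)
  · exact (purityAB_pos hκ hκ' hu hu' hw hw' le_rfl zero_le_one hx).ne'
  · exact (purityA_pos hκ hκ' hu hu' le_rfl).ne'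
  · exact (purityB_pos hκ hκ' hu hw hw' le_rfl hx).ne'

end Purities

/-! ### The transfer matrix for two copies -/

theorem univ_perm_fin_two : (Finset.univ : Finset (Equiv.Perm (Fin 2))) = {1, Equiv.swap 0 1} := by
  decide

theorem numCycles_one : numCycles (1 : Equiv.Perm (Fin 2)) = 2 := by
  simp [numCycles, Equiv.Perm.parts_partition]

theorem numCycles_swap : numCycles (Equiv.swap (0 : Fin 2) 1) = 1 := by
  have h : (Equiv.swap (0 : Fin 2) 1).IsSwap := ⟨0, 1, by decide, rfl⟩
  simp [numCycles, Equiv.Perm.parts_partition, Equiv.Perm.card_cycleType_eq_one.2 h.isCycle]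

theorem sum_perm_fin_two (f : Equiv.Perm (Fin 2) → ℝ) :
    ∑ σ, f σ = f 1 + f (Equiv.swap 0 1) := by
  rw [univ_perm_fin_two, Finset.sum_pair (by decide)]

theorem perm_fin_two_eq (σ : Equiv.Perm (Fin 2)) : σ = 1 ∨ σ = Equiv.swap 0 1 := by
  revert σ
  decide

theorem weingarten_two {q : ℕ} (hq : 2 ≤ q) :
    weingarten 2 q = Matrix.of fun σ τ => if σ = τ then 1 / ((q : ℝ) ^ 2 - 1) else
      -1 / ((q : ℝ) * ((q : ℝ) ^ 2 - 1)) := by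
  have hq' : (2 : ℝ) ≤ q := by exact_mod_cast hq
  have h0 : (q : ℝ) ≠ 0 := by linarith
  have h1 : (q : ℝ) ^ 2 - 1 ≠ 0 := by nlinarith
  have hs : (1 : Equiv.Perm (Fin 2)) ≠ Equiv.swap 0 1 := by decide
  refine Matrix.inv_eq_left_inv (Matrix.ext fun σ τ => ?_)
  rw [Matrix.mul_apply, sum_perm_fin_two]
  rcases perm_fin_two_eq σ with rfl | rfl <;> rcases perm_fin_two_eq τ with rfl | rfl <;>
  · simp [gram, hs, hs.symm, numCycles_one, numCycles_swap]
    field_simp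
    try ring

/-- The matrix is that of a traced site in `siteStep`, which identifies λ₂ here with the decay rate
found by averaging. -/
theorem transferMatrix_two_submatrix {d D : ℕ} (hd : 2 ≤ d) (hD : 2 ≤ D) :
    (transferMatrix 2 d D 1).submatrix ![1, Equiv.swap 0 1] ![1, Equiv.swap 0 1] =
      !![1, mu d D; 0, lam d D] := by
  have hd' : (2 : ℝ) ≤ d := by exact_mod_cast hd
  have hD' : (2 : ℝ) ≤ D := by exact_mod_cast hD
  have h0 : (d : ℝ) ≠ 0 := by linarith
  have h0' : (D : ℝ) ≠ 0 := by linarith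
  have hN : (d : ℝ) ^ 2 * (D : ℝ) ^ 2 - 1 ≠ 0 := by
    nlinarith [mul_le_mul hd' hD' (by norm_num) (by linarith)]
  have hs : (1 : Equiv.Perm (Fin 2)) ≠ Equiv.swap 0 1 := by decide
  have hq : 2 ≤ d * D := by nlinarith
  ext i j
  fin_cases i <;> fin_cases j <;>
  · simp [transferMatrix, sum_perm_fin_two, weingarten_two hq, hs, hs.symm, numCycles_one,
      numCycles_swap, lam, mu, mul_pow]
    field_simp
    try ring

/-- The permutations of two elements, in the order `e, (1 2)`. -/
def permFinTwoEquiv : Fin 2 ≃ Equiv.Perm (Fin 2) :=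
  Equiv.ofBijective ![1, Equiv.swap 0 1] (by decide)

theorem spectrum_transferMatrix_two {d D : ℕ} (hd : 2 ≤ d) (hD : 2 ≤ D) :
    spectrum ℝ (transferMatrix 2 d D 1) = {1, lam d D} := by
  have h : Matrix.reindexAlgEquiv ℝ ℝ permFinTwoEquiv.symm (transferMatrix 2 d D 1) =
      !![1, mu d D; 0, lam d D] := transferMatrix_two_submatrix hd hD
  rw [← AlgEquiv.spectrum_eq (Matrix.reindexAlgEquiv ℝ ℝ permFinTwoEquiv.symm), h]
  ext z
  rw [spectrum.mem_iff, Matrix.isUnit_iff_isUnit_det, isUnit_iff_ne_zero, not_not,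
    Matrix.det_fin_two]
  simp [Matrix.algebraMap_matrix_apply, sub_eq_zero]

theorem xi1D_eq (d D : ℕ) : xi1D d D = -(Real.log (lam d D))⁻¹ := rfl

end RandomMPS

end

theorem mainTheorem3 (d D : ℕ) [NeZero d] [NeZero D] (hd : 2 ≤ d) (hD : 2 ≤ D) :
    -- the transfer matrix `T_e` for `S_2`, in the basis `e, (1 2)`, and its eigenvalues
    ((RandomMPS.transferMatrix 2 d D 1).submatrix ![1, Equiv.swap 0 1] ![1, Equiv.swap 0 1] =
        !![1, ((d : ℝ) ^ 2 * D - D) / ((d : ℝ) ^ 2 * (D : ℝ) ^ 2 - 1);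
           0, ((d : ℝ) * (D : ℝ) ^ 2 - d) / ((d : ℝ) ^ 2 * (D : ℝ) ^ 2 - 1)] ∧
      spectrum ℝ (RandomMPS.transferMatrix 2 d D 1) =
        {1, ((d : ℝ) * (D : ℝ) ^ 2 - d) / ((d : ℝ) ^ 2 * (D : ℝ) ^ 2 - 1)} ∧
      0 < ((d : ℝ) * (D : ℝ) ^ 2 - d) / ((d : ℝ) ^ 2 * (D : ℝ) ^ 2 - 1) ∧
      ((d : ℝ) * (D : ℝ) ^ 2 - d) / ((d : ℝ) ^ 2 * (D : ℝ) ^ 2 - 1) < 1) ∧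
    -- the average purities are well defined and positive
    (∀ (n : ℕ) (S : Finset (Fin n)),
      Integrable (RandomMPS.purity S) (RandomMPS.ensemble d D n) ∧
        0 < RandomMPS.avgPurity d D S) ∧
    -- exponential decay, for any number `c` of initial sites and in the limit `c → ∞`
    ∀ a b f : ℕ, 1 ≤ a → 1 ≤ b → 1 ≤ f →
      (∀ c : ℕ, RandomMPS.DecaysExponentially
        (fun r => RandomMPS.annealedI2 d D c a r b f) (RandomMPS.xi1D d D)) ∧
      ∃ J : ℕ → ℝ,
        (∀ r : ℕ, Tendsto (fun c => RandomMPS.annealedI2 d D c a r b f) atTop (𝓝 (J r))) ∧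
        RandomMPS.DecaysExponentially J (RandomMPS.xi1D d D) := by
  have hl := RandomMPS.lam_pos hd hD
  have hl' := RandomMPS.lam_lt_one hd hD
  have hκ := RandomMPS.kap_pos hd hD
  have hκ' := RandomMPS.kap_lt_one hd hD
  refine ⟨⟨RandomMPS.transferMatrix_two_submatrix hd hD,
    RandomMPS.spectrum_transferMatrix_two hd hD, hl, hl'⟩,
    fun n S => ⟨RandomMPS.integrable_purity S, ?_⟩, fun a b f ha hb _ => ?_⟩
  · rw [RandomMPS.avgPurity_eq hd hD]
    exact (RandomMPS.pairingCoeff_pos hd hD _).2.2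
  have hu := pow_pos hl a
  have hu' := pow_lt_one₀ hl.le hl' (Nat.one_le_iff_ne_zero.1 ha)
  have hw := pow_pos hl b
  have hw' := pow_lt_one₀ hl.le hl' (Nat.one_le_iff_ne_zero.1 hb)
  -- From here finite c is t = λ₂ ^ c and the limit is t = 0, both covered by the same decay lemma.
  simp only [RandomMPS.annealedI2_eq hd hD, RandomMPS.xi1D_eq]
  exact ⟨fun c => RandomMPS.decaysExponentially_log_purity hl hl' hκ hκ' hu hu' hw hw'
      (pow_nonneg hl.le c) (pow_le_one₀ hl.le hl'.le), _,
    fun r => RandomMPS.tendsto_log_purity hl hl' hκ hκ' hu hu' hw hw' (pow_nonneg hl.le r),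
    RandomMPS.decaysExponentially_log_purity hl hl' hκ hκ' hu hu' hw hw' le_rfl zero_le_one⟩
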